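/- Boolean algebras. For Boolean algebras $A,B$ and $U\subseteq A$, a map $f:U\to B$ is called $2$-preserving if for all $a,b\in U$ (possibly equal), $a\cdot b=0$ implies $f(a)\cdot f(b)=0$. A Boolean algebra $A$ is $2$-free if there is a subset $X\subseteq A$ such that for every nontrivial Boolean algebra $B$, every $2$-preserving map $X\to B$ extends to a unique homomorphism $A\to B$. Let $\mathrm{FinCo}(\omega_1)$ be the algebra of finite and cofinite subsets of $\omega_1$, and $\mathrm{Fr}(\omega_1)$ the free Boolean algebra on $\omega_1$ generators, realized as the algebra of subsets of the Cantor space $\{0,1\}^{\omega_1}$ generated by the sets $\{f : f(\alpha)=1\}$, $\alpha<\omega_1$. Spaces. The dual space of a Boolean algebra is its space of ultrafilters with the Stone topology. A topological space is supercompact if it has an open subbase such that every cover of the space by members of the subbase has a subcover with at most two members. For a loopless undirected graph $G$ with vertex set $V$, the clique graph space of $G$ is the subspace of $\{0,1\}^V$ (with the product of the discrete topologies) consisting of the characteristic functions of cliques of $G$; a graph space is a space homeomorphic to the clique graph space of some such graph. Theorem. The algebras $\mathrm{FinCo}(\omega_1)$ and $\mathrm{Fr}(\omega_1)$ are both $2$-free,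 but their product $\mathrm{FinCo}(\omega_1)\times\mathrm{Fr}(\omega_1)$ is not $2$-free; so a product of two $2$-free Boolean algebras need not be $2$-free. Moreover, the dual space of $\mathrm{FinCo}(\omega_1)\times\mathrm{Fr}(\omega_1)$ is supercompact but is not a graph space. -/

import Mathlib

open scoped Ordinal

universe u v

/-- A map `f : U → B` on a subset `U` of a Boolean algebra `A` is `n`-preserving if
`a₀ ⋯ aₙ₋₁ = 0` implies `f a₀ ⋯ f aₙ₋₁ = 0` for all `a₀, …, aₙ₋₁ ∈ U` (repetitions allowed). -/
def IsNPreserving {A : Type u} {B : Type v} [BooleanAlgebra A] [BooleanAlgebra B]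
    (n : ℕ) {U : Set A} (f : U → B) : Prop :=
  ∀ a : Fin n → U,
    (Finset.univ.inf fun i => (a i : A)) = ⊥ → (Finset.univ.inf fun i => f (a i)) = ⊥

/-- `A` is `n`-free over `X` if every `n`-preserving map from `X` to a nontrivial Boolean algebra
extends to a unique homomorphism of Boolean algebras on `A`. -/
def IsNFreeOver (n : ℕ) (A : Type u) [BooleanAlgebra A] (X : Set A) : Prop :=
  ∀ (B : Type v) [BooleanAlgebra B] [Nontrivial B] (f : X → B), IsNPreserving n f →
    ∃! g : BoundedLatticeHom A B, ∀ x : X, g x = f x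

/-- `A` is `n`-free (`n ≥ 1`) if it is `n`-free over some subset. -/
def IsNFree (n : ℕ) (A : Type u) [BooleanAlgebra A] : Prop :=
  ∃ X : Set A, IsNFreeOver.{u, v} n A X

/-- The algebra of finite and cofinite subsets of `κ`. -/
def FinCo (κ : Type u) : BooleanSubalgebra (Set κ) where
  carrier := {s | s.Finite ∨ sᶜ.Finite}
  supClosed' := by
    rintro s hs t ht
    simp only [Set.mem_ofPred_eq, Set.sup_eq_union, Set.compl_union] at *
    rcases hs with hs | hs
    · rcases ht with ht | ht
      · exact Or.inl (hs.union ht)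
      · exact Or.inr (ht.subset Set.inter_subset_right)
    · exact Or.inr (hs.subset Set.inter_subset_left)
  infClosed' := by
    rintro s hs t ht
    simp only [Set.mem_ofPred_eq, Set.inf_eq_inter, Set.compl_inter] at *
    rcases hs with hs | hs
    · exact Or.inl (hs.subset Set.inter_subset_left)
    · rcases ht with ht | ht
      · exact Or.inl (ht.subset Set.inter_subset_right)
      · exact Or.inr (hs.union ht)
  compl_mem' := by
    intro s hs
    simpa only [Set.mem_ofPred_eq, compl_compl] using hs.symm
  bot_mem' := Or.inl Set.finite_empty

/-- The free Boolean algebra on `κ`: the algebra of subsets of the Cantor space `2^κ` generated by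
the independent family of the sets `{f | f i = 1}`, `i : κ`. -/
def Fr (κ : Type u) : BooleanSubalgebra (Set (κ → Bool)) :=
  BooleanSubalgebra.closure (Set.range fun i : κ => {f : κ → Bool | f i = true})

/-- An ultrafilter of a Boolean algebra. -/
@[ext]
structure Ult (A : Type u) [BooleanAlgebra A] where
  carrier : Set A
  top_mem : ⊤ ∈ carrier
  bot_notMem : ⊥ ∉ carrier
  inf_mem : ∀ a ∈ carrier, ∀ b ∈ carrier, a ⊓ b ∈ carrier
  mem_of_le : ∀ a ∈ carrier, ∀ b, a ≤ b → b ∈ carrier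
  mem_or_compl_mem : ∀ a, a ∈ carrier ∨ aᶜ ∈ carrier

/-- The Stone topology: the sets of all ultrafilters containing a given element of the algebra
form a base (they are closed under finite intersections). -/
instance (A : Type u) [BooleanAlgebra A] : TopologicalSpace (Ult A) :=
  TopologicalSpace.generateFrom (Set.range fun a : A => {p : Ult A | a ∈ p.carrier})

/-- A space is supercompact if it has an open subbase such that every cover by members of the
subbase has a subcover with at most two members. -/
def IsSupercompact (T : Type u) [t : TopologicalSpace T] : Prop :=
  ∃ S : Set (Set T), t = TopologicalSpace.generateFrom S ∧
    ∀ C ⊆ S, ⋃₀ C = Set.univ → ∃ D ⊆ C, D.encard ≤ 2 ∧ ⋃₀ D = Set.univ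

/-- The set of (characteristic functions of) cliques of a graph. As a subspace of the product
`V → Bool` of discrete spaces it is the clique graph space of `G`. -/
def cliqueSpace {V : Type v} (G : SimpleGraph V) : Set (V → Bool) :=
  {f | G.IsClique {x | f x = true}}

/-- A graph space is a space homeomorphic to the clique graph space of some (loopless) graph. -/
def IsGraphSpace (T : Type u) [TopologicalSpace T] : Prop :=
  ∃ (V : Type v) (G : SimpleGraph V), Nonempty (T ≃ₜ cliqueSpace G)

/-!
An ultrafilter of an algebra that is `2`-free over `X` is determined by the clique it traces on the
graph of nonzero members of `X` joined when they meet, and every clique is such a trace; so dual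
spaces of `2`-free algebras are graph spaces, and everything reduces to the space
`OnePoint κ ⊕ 2^κ` dual to `FinCo κ × Fr κ`, with `κ` uncountable.

If this space were the clique space of a graph, the empty clique would lie in one of the two
summands. Since a neighborhood of the empty clique contains all cliques that avoid some finite set
`F`, erasing `F` sends every clique into that summand. If the summand is `OnePoint κ`, there are at
most `κ` cliques, fewer than the points of `2^κ`. If it is `2^κ`, each of the uncountably many
isolated cliques yields a nonempty open subset of `2^κ`, formed by the cliques that contain it
outside `F`. By Bergelson's lemma for the product measure, infinitely many of these open sets have
a common point. But infinitely many isolated cliques cannot be contained, outside `F`, in a single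
clique: infinitely many of them would have the same trace on `F`, hence a clique as union, whereas
a clique that contains an isolated one is finite.
-/

open scoped Topology

section Ultrafilters

variable {A : Type u} {B : Type v} [BooleanAlgebra A] [BooleanAlgebra B]

namespace Ult

instance : SetLike (Ult A) A where
  coe := carrier
  coe_injective _ _ := Ult.ext

variable {p q : Ult A} {a b : A}

@[simp]
lemma mem_carrier : a ∈ p.carrier ↔ a ∈ p := Iff.rfl

lemma compl_mem_iff : aᶜ ∈ p ↔ a ∉ p := by
  refine ⟨fun hac ha => p.bot_notMem ?_, (p.mem_or_compl_mem a).resolve_left⟩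
  simpa only [inf_compl_eq_bot] using p.inf_mem a ha aᶜ hac

lemma inf_mem_iff : a ⊓ b ∈ p ↔ a ∈ p ∧ b ∈ p :=
  ⟨fun h => ⟨p.mem_of_le _ h _ inf_le_left, p.mem_of_le _ h _ inf_le_right⟩,
    fun h => p.inf_mem _ h.1 _ h.2⟩

lemma sup_mem_iff : a ⊔ b ∈ p ↔ a ∈ p ∨ b ∈ p := by
  rw [← compl_compl (a ⊔ b), compl_mem_iff, compl_sup, inf_mem_iff, compl_mem_iff, compl_mem_iff,
    not_and_or, not_not, not_not]

lemma finsetInf_mem_iff {ι : Type*} {s : Finset ι} {a : ι → A} :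
    s.inf a ∈ p ↔ ∀ i ∈ s, a i ∈ p := by
  induction s using Finset.cons_induction with
  | empty => simpa using p.top_mem
  | cons i s hi ih => simp only [Finset.inf_cons, inf_mem_iff, ih, Finset.forall_mem_cons]

lemma eq_of_forall_mem (h : ∀ a ∈ p, a ∈ q) : p = q :=
  SetLike.ext fun a => ⟨h a, fun ha => by_contra fun hap =>
    compl_mem_iff.1 (h _ (compl_mem_iff.2 hap)) ha⟩

lemma eq_of_closure_eq_top {X : Set A} (hX : BooleanSubalgebra.closure X = ⊤)
    (h : ∀ x ∈ X, x ∈ p ↔ x ∈ q) : p = q := by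
  refine SetLike.ext fun a => ?_
  have ha : a ∈ BooleanSubalgebra.closure X := hX ▸ BooleanSubalgebra.mem_top
  induction ha using BooleanSubalgebra.closure_bot_sup_induction with
  | mem x hx => exact h x hx
  | bot => exact iff_of_false p.bot_notMem q.bot_notMem
  | sup x _ y _ hx hy => simp only [sup_mem_iff, hx, hy]
  | compl x _ hx => simp only [compl_mem_iff, hx]

/-- The ultrafilter complementary to a prime ideal. -/
def ofPrimeIdeal (J : Order.Ideal A) (hJ : J.IsPrime) : Ult A where
  carrier := {a | a ∉ J}
  top_mem := hJ.toIsProper.top_notMem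
  bot_notMem h := h J.bot_mem
  inf_mem _ ha _ hb hab := (hJ.mem_or_mem hab).elim ha hb
  mem_of_le _ ha _ hab hb := ha (J.lower hab hb)
  mem_or_compl_mem a := by
    by_contra! h
    simp only [Set.mem_ofPred_eq, not_not] at h
    exact hJ.toIsProper.top_notMem (sup_compl_eq_top (x := a) ▸ J.sup_mem h.1 h.2)

lemma exists_mem_of_ne_bot (ha : a ≠ ⊥) : ∃ p : Ult A, a ∈ p := by
  have hproper : (Order.Ideal.principal aᶜ).IsProper :=
    Order.Ideal.isProper_of_notMem (p := ⊤) fun h => ha (by simpa using h)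
  obtain ⟨J, hJa, hJ⟩ := hproper.exists_le_maximal
  refine ⟨ofPrimeIdeal J inferInstance, fun haJ => hJ.toIsProper.top_notMem ?_⟩
  exact sup_compl_eq_top (x := a) ▸ J.sup_mem haJ (hJa (Order.Ideal.mem_principal.2 le_rfl))

lemma eq_of_forall_mem_iff (h : ∀ p : Ult A, a ∈ p ↔ b ∈ p) : a = b := by
  rw [← symmDiff_eq_bot]
  by_contra hne
  obtain ⟨p, hp⟩ := exists_mem_of_ne_bot hne
  rw [symmDiff_eq, sup_mem_iff, inf_mem_iff, inf_mem_iff, compl_mem_iff, compl_mem_iff, h p] at hp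
  tauto

/-- The ultrafilter induced on `A` along a homomorphism `A → B`. -/
def comap (g : BoundedLatticeHom A B) (q : Ult B) : Ult A where
  carrier := {a | g a ∈ q}
  top_mem := by simpa using q.top_mem
  bot_notMem := by simpa using q.bot_notMem
  inf_mem a ha b hb := by simpa using q.inf_mem _ ha _ hb
  mem_of_le a ha b hab := q.mem_of_le _ ha _ (OrderHomClass.mono g hab)
  mem_or_compl_mem a := by simpa using q.mem_or_compl_mem (g a)

@[simp]
lemma mem_comap {g : BoundedLatticeHom A B} {q : Ult B} : a ∈ comap g q ↔ g a ∈ q := Iff.rfl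

lemma comap_left_injective :
    Function.Injective (comap : BoundedLatticeHom A B → Ult B → Ult A) := fun g g' h =>
  DFunLike.ext g g' fun a => eq_of_forall_mem_iff fun q => by rw [← mem_comap, h, mem_comap]

lemma comap_injective {g : BoundedLatticeHom A B} (hg : Function.Surjective g) :
    Function.Injective (comap g) := fun q q' h =>
  SetLike.ext <| hg.forall.2 fun a => by rw [← mem_comap, h, mem_comap]

lemma exists_comap_eq {g : BoundedLatticeHom A B} (hg : Function.Surjective g)
    (hp : ∀ a ∈ p, g a ≠ ⊥) : ∃ q, comap g q = p := by
  refine ⟨⟨g '' p, ⟨⊤, p.top_mem, map_top g⟩, ?_, ?_, ?_, hg.forall.2 fun a => ?_⟩, ?_⟩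
  · rintro ⟨a, ha, hbot⟩
    exact hp a ha hbot
  · rintro _ ⟨a, ha, rfl⟩ _ ⟨b, hb, rfl⟩
    exact ⟨a ⊓ b, p.inf_mem a ha b hb, map_inf g a b⟩
  · rintro _ ⟨a, ha, rfl⟩ b hab
    obtain ⟨b, rfl⟩ := hg b
    exact ⟨a ⊔ b, p.mem_of_le a ha _ le_sup_left, by rw [map_sup, sup_eq_right.2 hab]⟩
  · rw [← map_compl']
    exact (p.mem_or_compl_mem a).imp (Set.mem_image_of_mem g) (Set.mem_image_of_mem g)
  · exact (eq_of_forall_mem fun a ha => Set.mem_image_of_mem g ha).symm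

lemma exists_boundedLatticeHom_comap_eq {P : Ult B → Ult A}
    (hP : ∀ a, ∃ b, ∀ q, b ∈ q ↔ a ∈ P q) : ∃ g : BoundedLatticeHom A B, comap g = P := by
  choose g hg using hP
  refine ⟨⟨⟨⟨g, fun a b => ?_⟩, fun a b => ?_⟩, ?_, ?_⟩,
    funext fun q => SetLike.ext fun a => hg a q⟩ <;>
    refine eq_of_forall_mem_iff fun q => ?_
  · simp only [hg, sup_mem_iff]
  · simp only [hg, inf_mem_iff]
  · exact (hg ⊤ q).trans (iff_of_true (P q).top_mem q.top_mem)
  · exact (hg ⊥ q).trans (iff_of_false (P q).bot_notMem q.bot_notMem)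

/-- An ultrafilter on a type, as an ultrafilter of the power set algebra. -/
def ofUltrafilter {α : Type*} (F : Ultrafilter α) : Ult (Set α) where
  carrier := {s | s ∈ F}
  top_mem := Filter.univ_mem
  bot_notMem := F.empty_notMem
  inf_mem _ ha _ hb := Filter.inter_mem ha hb
  mem_of_le _ ha _ h := Filter.mem_of_superset ha h
  mem_or_compl_mem := F.mem_or_compl_mem

/-- The homomorphism into a power set algebra dual to a family of ultrafilters; for the family of
all ultrafilters it is the Stone representation. -/
def familyHom {α : Type*} (P : α → Ult A) : BoundedLatticeHom A (Set α) where
  toFun a := {i | a ∈ P i}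
  map_sup' _ _ := Set.ext fun _ => sup_mem_iff
  map_inf' _ _ := Set.ext fun _ => inf_mem_iff
  map_top' := Set.eq_univ_of_forall fun i => (P i).top_mem
  map_bot' := Set.eq_empty_of_forall_notMem fun i => (P i).bot_notMem

lemma isClopen_setOf_mem (a : A) : IsClopen {p : Ult A | a ∈ p} := by
  have hopen (a : A) : IsOpen {p : Ult A | a ∈ p} :=
    TopologicalSpace.isOpen_generateFrom_of_mem ⟨a, rfl⟩
  refine ⟨⟨?_⟩, hopen a⟩
  simpa only [Set.compl_ofPred, compl_mem_iff] using hopen aᶜ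

lemma nhds_eq (p : Ult A) : 𝓝 p = ⨅ a ∈ p, Filter.principal {q : Ult A | a ∈ q} := by
  refine TopologicalSpace.nhds_generateFrom.trans (le_antisymm ?_ ?_)
  · exact le_iInf₂ fun a ha => iInf₂_le {q : Ult A | a ∈ q} ⟨ha, a, rfl⟩
  · refine le_iInf₂ ?_
    rintro _ ⟨ha, a, rfl⟩
    exact iInf₂_le a ha

instance : T2Space (Ult A) where
  t2 p q hpq := by
    obtain ⟨a, hap, haq⟩ : ∃ a ∈ p, a ∉ q := by
      by_contra! h
      exact hpq (eq_of_forall_mem h)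
    exact ⟨_, _, (isClopen_setOf_mem a).isOpen, (isClopen_setOf_mem a).compl.isOpen, hap, haq,
      disjoint_compl_right⟩

instance : CompactSpace (Ult A) where
  isCompact_univ := isCompact_iff_ultrafilter_le_nhds.2 fun F _ =>
    ⟨(ofUltrafilter F).comap (familyHom id), Set.mem_univ _,
      (nhds_eq _).ge.trans' (le_iInf₂ fun _ ha => Filter.le_principal_iff.2 ha)⟩

lemma continuous_comap (g : BoundedLatticeHom A B) : Continuous (comap g) := by
  refine continuous_generateFrom_iff.2 ?_
  rintro _ ⟨a, rfl⟩
  exact (isClopen_setOf_mem (g a)).isOpen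

variable (A B) in
/-- The first projection of a product of Boolean algebras. -/
def fstHom : BoundedLatticeHom (A × B) A :=
  { LatticeHom.fst with map_top' := rfl, map_bot' := rfl }

variable (A B) in
/-- The second projection of a product of Boolean algebras. -/
def sndHom : BoundedLatticeHom (A × B) B :=
  { LatticeHom.snd with map_top' := rfl, map_bot' := rfl }

lemma bijective_sumElim_comap :
    Function.Bijective (Sum.elim (comap (fstHom A B)) (comap (sndHom A B))) := by
  have hfst : Function.Surjective (fstHom A B) := Prod.fst_surjective
  have hsnd : Function.Surjective (sndHom A B) := Prod.snd_surjective
  refine ⟨(comap_injective hfst).sumElim (comap_injective hsnd) fun p q h => ?_, fun r => ?_⟩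
  · have hmem : ((⊤, ⊥) : A × B) ∈ comap (sndHom A B) q := h ▸ p.top_mem
    exact q.bot_notMem hmem
  · have hcases : ((⊤, ⊥) : A × B) ∈ r ∨ ((⊥, ⊤) : A × B) ∈ r := by
      rw [← sup_mem_iff, Prod.mk_sup_mk, sup_bot_eq, bot_sup_eq]
      exact r.top_mem
    rcases hcases with hr | hr
    · obtain ⟨p, rfl⟩ := exists_comap_eq hfst fun x hx hbot => r.bot_notMem <|
        r.mem_of_le _ (r.inf_mem x hx _ hr) ⊥ ⟨inf_le_left.trans hbot.le, inf_le_right⟩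
      exact ⟨Sum.inl p, rfl⟩
    · obtain ⟨q, rfl⟩ := exists_comap_eq hsnd fun x hx hbot => r.bot_notMem <|
        r.mem_of_le _ (r.inf_mem x hx _ hr) ⊥ ⟨inf_le_right, inf_le_left.trans hbot.le⟩
      exact ⟨Sum.inr q, rfl⟩

variable (A B) in
/-- The dual space of a product is the topological sum of the dual spaces. -/
noncomputable def sumHomeomorphProd : Ult A ⊕ Ult B ≃ₜ Ult (A × B) :=
  Continuous.homeoOfEquivCompactToT2 (f := Equiv.ofBijective _ bijective_sumElim_comap)
    ((continuous_comap _).sumElim (continuous_comap _))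

end Ult

end Ultrafilters

section NFree

variable {A : Type u} [BooleanAlgebra A] {n : ℕ} {X : Set A}

/-- A set is `n`-meeting if no `n` of its elements, repetitions allowed, have meet zero. -/
def IsNMeeting (n : ℕ) (K : Set A) : Prop :=
  ∀ a : Fin n → A, (∀ i, a i ∈ K) → Finset.univ.inf a ≠ ⊥

lemma isNMeeting_two_iff {K : Set A} :
    IsNMeeting 2 K ↔ ∀ a ∈ K, ∀ b ∈ K, a ⊓ b ≠ ⊥ := by
  refine ⟨fun h a ha b hb => ?_, fun h a ha => ?_⟩
  · simpa [Fin.univ_succ] using h ![a, b] (by simp [Fin.forall_fin_two, ha, hb])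
  · simpa [Fin.univ_succ] using h (a 0) (ha 0) (a 1) (ha 1)

lemma Ult.isNMeeting (p : Ult A) (n : ℕ) : IsNMeeting n (p : Set A) := fun _ ha hbot =>
  p.bot_notMem (hbot ▸ finsetInf_mem_iff.2 fun i _ => ha i)

lemma isNFreeOver_of_closure_eq_top (hX : BooleanSubalgebra.closure X = ⊤)
    (htrace : ∀ K, IsNMeeting n K → ∃ p : Ult A, ∀ x ∈ X, x ∈ p ↔ x ∈ K) :
    IsNFreeOver.{u, v} n A X := by
  intro B _ _ f hf
  have hpull (q : Ult B) : ∃ p : Ult A, ∀ x : X, (x : A) ∈ p ↔ f x ∈ q := by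
    obtain ⟨p, hp⟩ := htrace (Subtype.val '' {x : X | f x ∈ q}) fun a ha hbot => by
      choose x hx hxa using ha
      refine q.isNMeeting n (fun i => f (x i)) hx (hf x ?_)
      rwa [funext hxa]
    exact ⟨p, fun x => (hp x x.2).trans (Subtype.val_injective.mem_set_image)⟩
  choose P hP using hpull
  have hrep (a : A) : ∃ b : B, ∀ q, b ∈ q ↔ a ∈ P q := by
    have ha : a ∈ BooleanSubalgebra.closure X := hX ▸ BooleanSubalgebra.mem_top
    induction ha using BooleanSubalgebra.closure_bot_sup_induction with
    | mem x hx => exact ⟨f ⟨x, hx⟩, fun q => (hP q ⟨x, hx⟩).symm⟩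
    | bot => exact ⟨⊥, fun q => iff_of_false q.bot_notMem (P q).bot_notMem⟩
    | sup _ _ _ _ hx hy =>
      obtain ⟨⟨b, hb⟩, c, hc⟩ := hx, hy
      exact ⟨b ⊔ c, fun q => by rw [Ult.sup_mem_iff, Ult.sup_mem_iff, hb, hc]⟩
    | compl _ _ hx =>
      obtain ⟨b, hb⟩ := hx
      exact ⟨bᶜ, fun q => by rw [Ult.compl_mem_iff, Ult.compl_mem_iff, hb]⟩
  obtain ⟨g, hg⟩ := Ult.exists_boundedLatticeHom_comap_eq hrep
  refine ⟨g, fun x => Ult.eq_of_forall_mem_iff fun q => ?_, fun g' hg' => ?_⟩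
  · rw [← Ult.mem_comap, hg, hP]
  · refine Ult.comap_left_injective (funext fun q => ?_)
    refine Ult.eq_of_closure_eq_top hX fun x hx => ?_
    rw [hg, Ult.mem_comap, hg' ⟨x, hx⟩, hP q ⟨x, hx⟩]

lemma IsNFreeOver.existsUnique_ult (hX : IsNFreeOver.{u, v} n A X) {K : Set A}
    (hK : IsNMeeting n K) : ∃! p : Ult A, ∀ x ∈ X, x ∈ p ↔ x ∈ K := by
  let f : X → Set PUnit.{v + 1} := fun x => {_z | (x : A) ∈ K}
  have hf : IsNPreserving n f := by
    intro a ha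
    by_contra hne
    obtain ⟨z, hz⟩ := Set.nonempty_iff_ne_empty.2 hne
    simp only [Finset.inf_set_eq_iInter, Set.mem_iInter] at hz
    exact hK (fun i => a i) (fun i => hz i (Finset.mem_univ i)) ha
  obtain ⟨g, hgf, hunique⟩ := hX _ f hf
  refine ⟨(Ult.ofUltrafilter (pure PUnit.unit)).comap g, fun x hx => ?_, fun p hp => ?_⟩
  · rw [Ult.mem_comap, hgf ⟨x, hx⟩]
    rfl
  · rw [← hunique (Ult.familyHom fun _ => p) fun x => Set.ext fun _ => hp x x.2]
    rfl

end NFree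

section CliqueSpace

variable {V : Type v} {G : SimpleGraph V}

namespace cliqueSpace

/-- The clique whose characteristic function is `x`. -/
def support (x : cliqueSpace G) : Set V := {v | x.1 v = true}

lemma isClique_support (x : cliqueSpace G) : G.IsClique (support x) := x.2

open Classical in
/-- The point of the clique space given by a clique. -/
noncomputable def ofIsClique (s : Set V) (hs : G.IsClique s) : cliqueSpace G :=
  ⟨fun v => decide (v ∈ s), by simpa [cliqueSpace] using hs⟩

@[simp]
lemma support_ofIsClique {s : Set V} (hs : G.IsClique s) : support (ofIsClique s hs) = s := by
  ext v
  simp [support, ofIsClique]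

lemma support_injective : Function.Injective (support : cliqueSpace G → Set V) := fun _ _ h =>
  Subtype.ext <| funext fun v => Bool.eq_iff_iff.2 (Set.ext_iff.1 h v)

variable (G) in
lemma isClopen_setOf_mem_support (v : V) : IsClopen {x : cliqueSpace G | v ∈ support x} :=
  (isClopen_discrete {true}).preimage ((continuous_apply v).comp continuous_subtype_val)

lemma continuous_of_isClopen_support {T : Type*} {_ : TopologicalSpace T} {f : T → cliqueSpace G}
    (hf : ∀ v, IsClopen {t | v ∈ support (f t)}) : Continuous f :=
  Continuous.subtype_mk (continuous_pi fun v => continuous_bool_rng true |>.2 (hf v)) _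

/-- The intersection of a clique with a set of vertices. -/
noncomputable def restrict (x : cliqueSpace G) (s : Set V) : cliqueSpace G :=
  ofIsClique (support x ∩ s) ((isClique_support x).subset Set.inter_subset_left)

@[simp]
lemma support_restrict (x : cliqueSpace G) (s : Set V) :
    support (restrict x s) = support x ∩ s :=
  support_ofIsClique _

variable (G) in
/-- The empty clique. -/
noncomputable def empty : cliqueSpace G := ofIsClique ∅ SimpleGraph.isClique_empty

@[simp]
lemma support_empty : support (empty G) = ∅ := support_ofIsClique _

lemma exists_finite_of_mem_nhds {x : cliqueSpace G} {U : Set (cliqueSpace G)} (hU : U ∈ 𝓝 x) :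
    ∃ F : Set V, F.Finite ∧ ∀ y, support y ∩ F = support x ∩ F → y ∈ U := by
  obtain ⟨W, hW, hWU⟩ := (mem_nhds_subtype _ _ _).1 hU
  rw [nhds_pi, Filter.mem_pi] at hW
  obtain ⟨F, hF, t, ht, htW⟩ := hW
  refine ⟨F, hF, fun y hy => hWU (htW fun v hv => ?_)⟩
  have hyx : y.1 v = x.1 v :=
    Bool.eq_iff_iff.2 (and_congr_left_iff.1 (Set.ext_iff.1 hy v) hv)
  exact hyx ▸ mem_of_mem_nhds (ht v)

end cliqueSpace

end CliqueSpace

section MeetingGraph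

variable {A : Type u} [BooleanAlgebra A] {X : Set A}

/-- The graph on the nonzero elements of `X` in which two of them are joined if their meet is
nonzero; the zero element is left out since it lies in no ultrafilter. -/
def meetingGraph (X : Set A) : SimpleGraph ↥(X \ {⊥}) where
  Adj x y := x ≠ y ∧ (x : A) ⊓ y ≠ ⊥
  symm := ⟨fun _ _ h => ⟨h.1.symm, inf_comm (α := A) _ _ ▸ h.2⟩⟩

lemma meetingGraph_isClique_iff {s : Set ↥(X \ {⊥})} :
    (meetingGraph X).IsClique s ↔ IsNMeeting 2 (Subtype.val '' s) := by
  simp only [isNMeeting_two_iff, Set.forall_mem_image, SimpleGraph.isClique_iff, Set.Pairwise]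
  refine ⟨fun h x hx y hy => ?_, fun h x hx y hy hxy => ⟨hxy, h hx hy⟩⟩
  obtain rfl | hxy := eq_or_ne x y
  · simpa using x.2.2
  · exact (h hx hy hxy).2

/-- The clique of the members of `X` in an ultrafilter. -/
noncomputable def Ult.clique (X : Set A) (p : Ult A) : cliqueSpace (meetingGraph X) :=
  cliqueSpace.ofIsClique {x | (x : A) ∈ p} <| meetingGraph_isClique_iff.2 fun a ha =>
    p.isNMeeting 2 a fun i => by
      obtain ⟨x, hx, hxa⟩ := ha i
      exact hxa ▸ hx

lemma Ult.clique_eq_iff {p : Ult A} {x : cliqueSpace (meetingGraph X)} :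
    p.clique X = x ↔ ∀ a ∈ X, a ∈ p ↔ a ∈ Subtype.val '' cliqueSpace.support x := by
  rw [← cliqueSpace.support_injective.eq_iff, clique, cliqueSpace.support_ofIsClique, Set.ext_iff]
  refine ⟨fun h a ha => ?_, fun h a => (h a a.2.1).trans Subtype.val_injective.mem_set_image⟩
  obtain rfl | hbot := eq_or_ne a ⊥
  · refine iff_of_false p.bot_notMem ?_
    rintro ⟨b, -, hb⟩
    exact b.2.2 hb
  · exact (h ⟨a, ha, hbot⟩).trans Subtype.val_injective.mem_set_image.symm

lemma IsNFreeOver.bijective_clique (hX : IsNFreeOver.{u, v} 2 A X) :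
    Function.Bijective (Ult.clique X) := by
  refine Function.bijective_iff_existsUnique _ |>.2 fun x => ?_
  simpa only [Ult.clique_eq_iff] using
    hX.existsUnique_ult (meetingGraph_isClique_iff.1 (cliqueSpace.isClique_support x))

lemma Ult.continuous_clique (X : Set A) : Continuous (clique X) :=
  cliqueSpace.continuous_of_isClopen_support fun x => by
    simpa only [clique, cliqueSpace.support_ofIsClique] using! isClopen_setOf_mem (x : A)

/-- The dual space of a `2`-free algebra is the clique space of the meeting graph. -/
noncomputable def IsNFreeOver.homeomorphCliqueSpace (hX : IsNFreeOver.{u, v} 2 A X) :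
    Ult A ≃ₜ cliqueSpace (meetingGraph X) :=
  Continuous.homeoOfEquivCompactToT2 (f := Equiv.ofBijective _ hX.bijective_clique)
    (Ult.continuous_clique X)

lemma IsNFree.isGraphSpace (hA : IsNFree.{u, v} 2 A) : IsGraphSpace.{u, u} (Ult A) := by
  obtain ⟨X, hX⟩ := hA
  exact ⟨_, meetingGraph X, ⟨hX.homeomorphCliqueSpace⟩⟩

end MeetingGraph

section Supercompact

variable {T : Type u} {T' : Type v} [TopologicalSpace T] [TopologicalSpace T']

lemma isSupercompact_of_subbase (S : Set (Set T))
    (hS : ‹TopologicalSpace T› = TopologicalSpace.generateFrom S)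
    (hcover : ∀ C ⊆ S, C.Nonempty → ⋃₀ C = Set.univ → ∃ s ∈ C, ∃ t ∈ C, s ∪ t = Set.univ) :
    IsSupercompact T := by
  refine ⟨S, hS, fun C hCS hC => ?_⟩
  obtain rfl | hne := C.eq_empty_or_nonempty
  · exact ⟨∅, subset_rfl, by simp, hC⟩
  · obtain ⟨s, hs, t, ht, hst⟩ := hcover C hCS hne hC
    refine ⟨{s, t}, Set.pair_subset hs ht, ?_, Set.sUnion_pair s t ▸ hst⟩
    exact (Set.encard_insert_le _ _).trans (by rw [Set.encard_singleton, one_add_one_eq_two])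

lemma exists_union_eq_sUnion_of_encard_le_two {α : Type*} {D : Set (Set α)} (hne : D.Nonempty)
    (hD : D.encard ≤ 2) : ∃ s ∈ D, ∃ t ∈ D, s ∪ t = ⋃₀ D := by
  obtain ⟨s, hs⟩ := hne
  have hdiff : (D \ {s}).encard ≤ 1 := by
    rwa [← ENat.add_le_add_iff_right ENat.one_ne_top, Set.encard_sdiff_singleton_add_one hs,
      one_add_one_eq_two]
  rw [← Set.insert_sdiff_self_of_mem hs]
  obtain hempty | ⟨t, ht⟩ := Set.encard_le_one_iff_eq.1 hdiff
  · simp [hempty]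
  · exact ⟨s, by simp, t, by simp [ht], by rw [ht, Set.sUnion_pair]⟩

lemma IsSupercompact.exists_subbase (hT : IsSupercompact T) : ∃ S : Set (Set T), ∅ ∈ S ∧
    ‹TopologicalSpace T› = TopologicalSpace.generateFrom S ∧
      ∀ C ⊆ S, C.Nonempty → ⋃₀ C = Set.univ → ∃ s ∈ C, ∃ t ∈ C, s ∪ t = Set.univ := by
  obtain ⟨S, hS, hcover⟩ := hT
  refine ⟨insert ∅ S, Set.mem_insert _ _, ?_, fun C hCS hne hC => ?_⟩
  · rw [generateFrom_insert_empty, hS]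
  · obtain ⟨D, hDC, hD, hDuniv⟩ := hcover (C \ {∅}) (Set.sdiff_singleton_subset_iff.2 hCS)
      (by rw [Set.sUnion_sdiff_singleton_empty, hC])
    obtain rfl | hDne := D.eq_empty_or_nonempty
    · obtain ⟨s, hs⟩ := hne
      exact ⟨s, hs, s, hs, Set.univ_subset_iff.1 <| hDuniv ▸ by simp⟩
    · obtain ⟨s, hs, t, ht, hst⟩ := exists_union_eq_sUnion_of_encard_le_two hDne hD
      exact ⟨s, (hDC hs).1, t, (hDC ht).1, hst.trans hDuniv⟩

lemma IsSupercompact.of_homeomorph (hT : IsSupercompact T) (h : T ≃ₜ T') : IsSupercompact T' := by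
  obtain ⟨S, hS, hcover⟩ := hT
  refine ⟨Set.preimage h.symm '' S, ?_, fun C hCS hC => ?_⟩
  · rw [← induced_generateFrom_eq, ← hS, h.symm.induced_eq]
  · obtain ⟨C', hCS', rfl⟩ := Set.subset_image_iff.1 hCS
    simp only [Set.sUnion_image, ← Set.preimage_sUnion] at hC ⊢
    obtain ⟨D, hDC, hD, hDuniv⟩ := hcover C' hCS' <|
      h.symm.surjective.preimage_injective (hC.trans Set.preimage_univ.symm)
    refine ⟨_, Set.image_mono hDC, (Set.encard_image_le _ _).trans hD, ?_⟩
    rw [Set.sUnion_image, ← Set.preimage_sUnion, hDuniv, Set.preimage_univ]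

lemma isOpen_image_of_isOpen_generateFrom {α β : Type*} {_ : TopologicalSpace β}
    {S : Set (Set α)} {f : α → β} {s : Set α}
    (hf : IsOpen (Set.range f)) (hS : ∀ s ∈ S, ∃ U, IsOpen U ∧ f ⁻¹' U = s)
    (hs : IsOpen[TopologicalSpace.generateFrom S] s) : IsOpen (f '' s) := by
  obtain ⟨U, hU, rfl⟩ := (le_generateFrom hS : .induced f ‹_› ≤ _) s hs
  exact Set.image_preimage_eq_inter_range ▸ hU.inter hf

/-- The sum of two families of sets, each containing the empty set, as a subbase of the
topological sum: every member contains one of the two summands. -/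
def sumSubbase (S : Set (Set T)) (S' : Set (Set T')) : Set (Set (T ⊕ T')) :=
  {U | Sum.inl ⁻¹' U ∈ S ∧ Sum.inr ⁻¹' U = Set.univ ∨
    Sum.inl ⁻¹' U = Set.univ ∧ Sum.inr ⁻¹' U ∈ S'}

lemma generateFrom_sumSubbase {S : Set (Set T)} {S' : Set (Set T')} (hS0 : ∅ ∈ S) (hS0' : ∅ ∈ S')
    (hS : ‹TopologicalSpace T› = TopologicalSpace.generateFrom S)
    (hS' : ‹TopologicalSpace T'› = TopologicalSpace.generateFrom S') :
    TopologicalSpace.generateFrom (sumSubbase S S') = instTopologicalSpaceSum := by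
  have hopen {U} (hU : U ∈ sumSubbase S S') : IsOpen[.generateFrom (sumSubbase S S')] U :=
    TopologicalSpace.isOpen_generateFrom_of_mem hU
  refine le_antisymm (fun U hU => ?_) (le_generateFrom fun U hU => isOpen_sum_iff.2 ?_)
  · rw [isOpen_sum_iff, hS, hS'] at hU
    rw [← Set.image_preimage_inl_union_image_preimage_inr U]
    refine @IsOpen.union _ _ _ (_) (isOpen_image_of_isOpen_generateFrom ?_ (fun s hs => ?_) hU.1)
      (isOpen_image_of_isOpen_generateFrom ?_ (fun s hs => ?_) hU.2)
    · exact hopen (Or.inr (by simpa using hS0'))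
    · have hpre := Set.preimage_image_eq s (Sum.inl_injective (α := T) (β := T'))
      exact ⟨Sum.inl '' s ∪ Set.range Sum.inr, hopen (Or.inl (by simpa [hpre] using hs)),
        by simp [hpre]⟩
    · exact hopen (Or.inl (by simpa using hS0))
    · have hpre := Set.preimage_image_eq s (Sum.inr_injective (α := T) (β := T'))
      exact ⟨Set.range Sum.inl ∪ Sum.inr '' s, hopen (Or.inr (by simpa [hpre] using hs)),
        by simp [hpre]⟩
  · obtain ⟨hl, hr⟩ | ⟨hl, hr⟩ := hU
    · exact ⟨hS.le _ (.basic _ hl), hr ▸ isOpen_univ⟩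
    · exact ⟨hl ▸ isOpen_univ, hS'.le _ (.basic _ hr)⟩

lemma IsSupercompact.sum (hT : IsSupercompact T) (hT' : IsSupercompact T') :
    IsSupercompact (T ⊕ T') := by
  obtain ⟨S, hS0, hS, hcover⟩ := hT.exists_subbase
  obtain ⟨S', hS0', hS', hcover'⟩ := hT'.exists_subbase
  refine isSupercompact_of_subbase (sumSubbase S S')
    (generateFrom_sumSubbase hS0 hS0' hS hS').symm fun C hCS hne hC => ?_
  have univ_of_preimage {U : Set (T ⊕ T')} (hl : Sum.inl ⁻¹' U = Set.univ)
      (hr : Sum.inr ⁻¹' U = Set.univ) : U = Set.univ := by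
    rw [← Set.image_preimage_inl_union_image_preimage_inr U, hl, hr, Set.image_univ,
      Set.image_univ, Set.range_inl_union_range_inr]
  by_cases hr : ∀ U ∈ C, Sum.inl ⁻¹' U ∈ S ∧ Sum.inr ⁻¹' U = Set.univ
  · obtain ⟨_, ⟨U, hU, rfl⟩, _, ⟨W, hW, rfl⟩, hUW⟩ := hcover (Set.preimage Sum.inl '' C)
      (Set.image_subset_iff.2 fun U hU => (hr U hU).1) (hne.image _)
      (by rw [Set.sUnion_image, ← Set.preimage_sUnion, hC, Set.preimage_univ])
    exact ⟨U, hU, W, hW, univ_of_preimage hUW (by simp [(hr U hU).2])⟩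
  by_cases hl : ∀ U ∈ C, Sum.inl ⁻¹' U = Set.univ ∧ Sum.inr ⁻¹' U ∈ S'
  · obtain ⟨_, ⟨U, hU, rfl⟩, _, ⟨W, hW, rfl⟩, hUW⟩ := hcover' (Set.preimage Sum.inr '' C)
      (Set.image_subset_iff.2 fun U hU => (hl U hU).2) (hne.image _)
      (by rw [Set.sUnion_image, ← Set.preimage_sUnion, hC, Set.preimage_univ])
    exact ⟨U, hU, W, hW, univ_of_preimage (by simp [(hl U hU).1]) hUW⟩
  · push Not at hl hr
    obtain ⟨U, hU, hUr⟩ := hr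
    obtain ⟨W, hW, hWl⟩ := hl
    have hUl := (hCS hU).resolve_left fun h => hUr h.1 h.2
    have hWr := (hCS hW).resolve_right fun h => hWl h.1 h.2
    exact ⟨U, hU, W, hW, univ_of_preimage (by simp [hUl.1]) (by simp [hWr.2])⟩

lemma cliqueSpace.isSupercompact {V : Type v} (G : SimpleGraph V) :
    IsSupercompact (cliqueSpace G) := by
  let S : Set (Set (cliqueSpace G)) :=
    Set.range (fun v => {x | v ∈ support x}) ∪ Set.range fun v => {x | v ∉ support x}
  have hS (v : V) : @IsClopen _ (.generateFrom S) {x : cliqueSpace G | v ∈ support x} :=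
    ⟨@IsClosed.mk _ (_) _ (.basic _ (Or.inr ⟨v, rfl⟩)), .basic _ (Or.inl ⟨v, rfl⟩)⟩
  refine isSupercompact_of_subbase S (le_antisymm (le_generateFrom ?_)
    (continuous_id_iff_le.1 (continuous_of_isClopen_support hS))) fun C hCS _ hC => ?_
  · rintro _ (⟨v, rfl⟩ | ⟨v, rfl⟩)
    exacts [(isClopen_setOf_mem_support G v).isOpen, (isClopen_setOf_mem_support G v).compl.isOpen]
  by_cases hQ : G.IsClique {v | {x : cliqueSpace G | v ∉ support x} ∈ C}
  · obtain ⟨U, hU, hQU⟩ := Set.mem_sUnion.1 (hC ▸ Set.mem_univ (ofIsClique _ hQ))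
    obtain ⟨v, rfl⟩ | ⟨v, rfl⟩ := hCS hU
    · exact ⟨_, hU, {x | v ∉ support x}, by simpa using hQU, Set.union_compl_self _⟩
    · exact absurd hU (by simpa using hQU)
  · simp only [SimpleGraph.isClique_iff, Set.Pairwise] at hQ
    push Not at hQ
    obtain ⟨v, hv, w, hw, hvw, hadj⟩ := hQ
    refine ⟨_, hv, _, hw, Set.eq_univ_of_forall fun x => ?_⟩
    by_contra! hx
    simp only [Set.mem_union, Set.mem_ofPred_eq, not_or, not_not] at hx
    exact hadj (isClique_support x hx.1 hx.2 hvw)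

lemma IsGraphSpace.isSupercompact (hT : IsGraphSpace.{u, v} T) : IsSupercompact T := by
  obtain ⟨V, G, ⟨h⟩⟩ := hT
  exact (cliqueSpace.isSupercompact G).of_homeomorph h.symm

end Supercompact

section Caliber

open MeasureTheory

variable {T : Type u} [TopologicalSpace T]

/-- A space has caliber `(ω₁, ω)` if every uncountable family of nonempty open sets has infinitely
many members with a common point. -/
def HasCaliberOmegaOneOmega (T : Type u) [TopologicalSpace T] : Prop :=
  ∀ (ι : Type v) [Uncountable ι] (U : ι → Set T), (∀ i, IsOpen (U i)) → (∀ i, (U i).Nonempty) →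
    ∃ t, {i | t ∈ U i}.Infinite

lemma HasCaliberOmegaOneOmega.of_measure [CompactSpace T] [MeasurableSpace T] (μ : Measure T)
    [IsFiniteMeasure μ]
    (hμ : ∀ U : Set T, IsOpen U → U.Nonempty →
      ∃ C ⊆ U, IsClosed C ∧ MeasurableSet C ∧ μ C ≠ 0) :
    HasCaliberOmegaOneOmega.{u, v} T := by
  intro ι _ U hU hne
  choose C hCU hCclosed hC hμC using fun i => hμ (U i) (hU i) (hne i)
  choose n hn using fun i => ENNReal.exists_inv_nat_lt (hμC i)
  let level : ι → ULift.{v} ℕ := fun i => ⟨n i⟩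
  obtain ⟨m, _⟩ := Cardinal.exists_infinite_fiber level (by simp)
  obtain ⟨I, hI, hIpos⟩ := bergelson (μ := μ) (s := fun i : level ⁻¹' {m} => C i) (fun i => hC i.1)
    (ENNReal.inv_ne_zero.2 (ENNReal.natCast_ne_top m.down)) <| by
      rintro ⟨i, rfl⟩
      exact (hn i).le
  obtain ⟨t, ht⟩ : (⋂ i : I, C i).Nonempty := by
    refine CompactSpace.iInter_nonempty (fun i => hCclosed i) fun s => nonempty_of_measure_ne_zero
      (μ := μ) ?_
    simpa using (hIpos (u := Subtype.val '' (s : Set I)) (by simp) (s.finite_toSet.image _)).ne'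
  simp only [Set.mem_iInter] at ht
  refine ⟨t, (hI.image Subtype.val_injective.injOn).mono ?_⟩
  rintro _ ⟨i, hi, rfl⟩
  exact hCU i (ht ⟨i, hi⟩)

lemma hasCaliberOmegaOneOmega_cube (κ : Type u) : HasCaliberOmegaOneOmega.{u, v} (κ → Bool) := by
  let μ := Measure.infinitePi fun _ : κ => (PMF.uniformOfFintype Bool).toMeasure
  refine HasCaliberOmegaOneOmega.of_measure μ fun U hU ⟨f, hf⟩ => ?_
  obtain ⟨F, u, hu, hFU⟩ := isOpen_pi_iff.1 hU f hf
  refine ⟨Set.pi F fun k => {f k}, (Set.pi_mono fun k hk => ?_).trans hFU, ?_, ?_, ?_⟩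
  · exact Set.singleton_subset_iff.2 (hu k hk).2
  · exact isClosed_set_pi fun _ _ => isClosed_singleton
  · exact .pi F.countable_toSet fun _ _ => measurableSet_singleton _
  · rw [Measure.infinitePi_pi _ fun _ _ => measurableSet_singleton _, Finset.prod_ne_zero_iff]
    simp

end Caliber

section Obstruction

namespace cliqueSpace

variable {V : Type v} {G : SimpleGraph V}

lemma finite_support_of_isOpen_singleton {x y : cliqueSpace G} (hx : IsOpen {x})
    (hxy : support x ⊆ support y) : (support y).Finite := by
  obtain ⟨F, hF, hFx⟩ := exists_finite_of_mem_nhds (hx.mem_nhds rfl)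
  have hxF : restrict x F = x := hFx _ (by simp)
  have hyx : restrict y (support x ∪ Fᶜ) = x := hFx _ (by grind [support_restrict])
  refine hF.subset fun v hv => by_contra fun hvF => hvF ?_
  have hvx : v ∈ support (restrict y (support x ∪ Fᶜ)) := by simp [hv, hvF]
  rw [hyx, ← hxF, support_restrict] at hvx
  exact hvx.2

lemma finite_setOf_isOpen_singleton_of_inter_eq (c : cliqueSpace G) (F E : Set V) :
    {x : cliqueSpace G |
      IsOpen {x} ∧ support x \ F ⊆ support c ∧ support x ∩ F = E}.Finite := by
  set S := {x : cliqueSpace G | IsOpen {x} ∧ support x \ F ⊆ support c ∧ support x ∩ F = E}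
  obtain hempty | ⟨x₀, hx₀⟩ := S.eq_empty_or_nonempty
  · simp [hempty]
  have hclique : G.IsClique (⋃ x ∈ S, support x) := by
    intro v hv w hw hvw
    simp only [Set.mem_iUnion] at hv hw
    obtain ⟨x, ⟨-, hxc, hxE⟩, hv⟩ := hv
    obtain ⟨y, ⟨-, hyc, hyE⟩, hw⟩ := hw
    by_cases hvF : v ∈ F
    · exact isClique_support y (hyE.ge.trans Set.inter_subset_left (hxE ▸ ⟨hv, hvF⟩)) hw hvw
    by_cases hwF : w ∈ F
    · exact isClique_support x hv (hxE.ge.trans Set.inter_subset_left (hyE ▸ ⟨hw, hwF⟩)) hvw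
    · exact isClique_support c (hxc ⟨hv, hvF⟩) (hyc ⟨hw, hwF⟩) hvw
  have hfinite : (⋃ x ∈ S, support x).Finite := by
    have hsub : support x₀ ⊆ support (ofIsClique _ hclique) :=
      (Set.subset_biUnion_of_mem (u := support) hx₀).trans (support_ofIsClique hclique).ge
    simpa only [support_ofIsClique] using finite_support_of_isOpen_singleton hx₀.1 hsub
  exact (hfinite.finite_subsets.preimage support_injective.injOn).subset fun x hx =>
    Set.subset_biUnion_of_mem (u := support) hx

lemma finite_setOf_isOpen_singleton_of_diff_subset (c : cliqueSpace G) {F : Set V}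
    (hF : F.Finite) : {x : cliqueSpace G | IsOpen {x} ∧ support x \ F ⊆ support c}.Finite :=
  (hF.finite_subsets.biUnion fun E _ => finite_setOf_isOpen_singleton_of_inter_eq c F E).subset
    fun x hx => Set.mem_biUnion (x := support x ∩ F) Set.inter_subset_right ⟨hx.1, hx.2, rfl⟩

lemma exists_finite_restrict_mem_of_mem_nhds_empty {U : Set (cliqueSpace G)}
    (hU : U ∈ 𝓝 (empty G)) : ∃ F : Set V, F.Finite ∧ ∀ x, restrict x Fᶜ ∈ U := by
  obtain ⟨F, hF, hFU⟩ := exists_finite_of_mem_nhds hU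
  exact ⟨F, hF, fun x => hFU _ (by simp [Set.inter_assoc])⟩

variable {S : Type u}

theorem countable_setOf_isOpen_singleton [TopologicalSpace S] {c : S → cliqueSpace G}
    (hc : Continuous c) (hrange : Set.range c ∈ 𝓝 (empty G))
    (hS : HasCaliberOmegaOneOmega.{u, v} S) : {x : cliqueSpace G | IsOpen {x}}.Countable := by
  by_contra hcount
  have : Uncountable {x : cliqueSpace G | IsOpen {x}} :=
    ⟨fun h => hcount (Set.countable_coe_iff.1 h)⟩
  obtain ⟨F, hF, hFc⟩ := exists_finite_restrict_mem_of_mem_nhds_empty hrange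
  let U : {x : cliqueSpace G | IsOpen {x}} → Set S :=
    fun x => {s | support x.1 \ F ⊆ support (c s)}
  have hUopen (x) : IsOpen (U x) := by
    have hfinite := finite_support_of_isOpen_singleton x.2 subset_rfl
    simpa only [U, Set.subset_def, Set.ofPred_forall] using! hfinite.sdiff.isOpen_biInter fun v _ =>
      (isClopen_setOf_mem_support G v).isOpen.preimage hc
  have hUne (x) : (U x).Nonempty := by
    obtain ⟨s, hs⟩ := hFc x
    exact ⟨s, by simp [U, hs, Set.sdiff_eq]⟩
  obtain ⟨s, hs⟩ := hS _ U hUopen hUne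
  refine hs (((finite_setOf_isOpen_singleton_of_diff_subset (c s) hF).preimage
    Subtype.val_injective.injOn).subset fun x hx => ⟨x.2, hx⟩)

theorem exists_injective_prod_nat {d : S → cliqueSpace G} (hd : Set.range d ∈ 𝓝 (empty G)) :
    ∃ e : cliqueSpace G → S × ℕ, Function.Injective e := by
  obtain ⟨F, hF, hFd⟩ := exists_finite_restrict_mem_of_mem_nhds_empty hd
  choose o ho using hFd
  have := hF.to_subtype
  obtain ⟨code, hcode⟩ := Countable.exists_injective_nat (Set F)
  refine ⟨fun x => (o x, code (Subtype.val ⁻¹' support x)), fun x y hxy => ?_⟩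
  obtain ⟨hoxy, htrace⟩ := Prod.mk.inj hxy
  have hout : support x ∩ Fᶜ = support y ∩ Fᶜ := by
    rw [← support_restrict, ← support_restrict, ← ho, ← ho, hoxy]
  have hin : support x ∩ F = support y ∩ F := by
    simpa [Set.inter_comm] using Subtype.preimage_val_eq_preimage_val_iff _ _ _ |>.1 (hcode htrace)
  refine support_injective ?_
  rw [← Set.inter_union_compl (support x) F, hin, hout, Set.inter_union_compl]

end cliqueSpace

variable {κ : Type u}

lemma not_injective_cube_onePoint_prod_nat [Infinite κ] (f : (κ → Bool) → OnePoint κ × ℕ) :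
    ¬ Function.Injective f := by
  intro hf
  have hκ := Cardinal.aleph0_le_mk κ
  have hcard : Cardinal.mk (OnePoint κ × ℕ) = Cardinal.mk κ := by
    rw [Cardinal.mk_prod, OnePoint, Cardinal.mk_option, Cardinal.add_one_eq hκ]
    simp [Cardinal.mul_aleph0_eq hκ]
  have hle := Cardinal.mk_le_of_injective hf
  rw [hcard] at hle
  exact hle.not_gt (by simpa using Cardinal.cantor (Cardinal.mk κ))

theorem not_isGraphSpace_onePoint_sum_cube [TopologicalSpace κ] [DiscreteTopology κ]
    [Uncountable κ] : ¬ IsGraphSpace.{u, v} (OnePoint κ ⊕ (κ → Bool)) := by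
  rintro ⟨V, G, ⟨h⟩⟩
  have hinl := h.isOpenEmbedding.comp Topology.IsOpenEmbedding.inl
  have hinr := h.isOpenEmbedding.comp Topology.IsOpenEmbedding.inr
  obtain ⟨o | f, hempty⟩ := h.surjective (cliqueSpace.empty G)
  · obtain ⟨e, he⟩ := cliqueSpace.exists_injective_prod_nat
      (hinl.isOpen_range.mem_nhds ⟨o, hempty⟩)
    exact not_injective_cube_onePoint_prod_nat _ (he.comp hinr.injective)
  · have hcount := cliqueSpace.countable_setOf_isOpen_singleton hinr.continuous
      (hinr.isOpen_range.mem_nhds ⟨f, hempty⟩) (hasCaliberOmegaOneOmega_cube κ)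
    have hsome := hinl.comp OnePoint.isOpenEmbedding_coe
    refine Set.not_countable_univ ((hcount.preimage hsome.injective).mono fun k _ => ?_)
    simpa using! hsome.isOpenMap _ (isOpen_discrete {k})

end Obstruction

section FinCo

variable {κ : Type u}

namespace FinCo

/-- The atom `{k}` of the finite-cofinite algebra. -/
def singleton (k : κ) : FinCo κ := ⟨{k}, Or.inl (Set.finite_singleton k)⟩

lemma mem_of_finite {L : BooleanSubalgebra (FinCo κ)} (hL : ∀ k, singleton k ∈ L)
    {s : Set κ} (hs : s.Finite) (hs' : s ∈ FinCo κ) : (⟨s, hs'⟩ : FinCo κ) ∈ L := by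
  induction s, hs using Set.Finite.induction_on with
  | empty => exact L.bot_mem
  | @insert a t _ ht ih => exact L.sup_mem (hL a) (ih (Or.inl ht))

lemma closure_range_singleton :
    BooleanSubalgebra.closure (Set.range (singleton : κ → FinCo κ)) = ⊤ := by
  refine eq_top_iff.2 fun s _ => ?_
  have hsingleton (k : κ) :=
    BooleanSubalgebra.subset_closure (Set.mem_range_self (f := singleton) k)
  obtain ⟨s, hs | hs⟩ := s
  · exact mem_of_finite hsingleton hs _
  · rw [← BooleanSubalgebra.compl_mem_iff]
    exact mem_of_finite hsingleton hs _

variable [Infinite κ]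

/-- The ultrafilters of the finite-cofinite algebra: the principal ones, and at `∞` the one of the
cofinite sets. -/
noncomputable def ult (o : OnePoint κ) : Ult (FinCo κ) :=
  (Ult.ofUltrafilter (o.elim (Filter.hyperfilter κ) pure)).comap (FinCo κ).subtype

lemma singleton_mem_ult {k : κ} {o : OnePoint κ} : singleton k ∈ ult o ↔ o = k := by
  induction o with
  | infty =>
    exact iff_of_false (Set.finite_singleton k).notMem_hyperfilter (OnePoint.infty_ne_coe k)
  | coe l => exact OnePoint.coe_eq_coe.symm

lemma exists_singleton_mem_ult_iff {K : Set (FinCo κ)} (hK : IsNMeeting 2 K) :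
    ∃ o, ∀ k, singleton k ∈ ult o ↔ singleton k ∈ K := by
  simp only [singleton_mem_ult]
  by_cases h : ∃ k, singleton k ∈ K
  · obtain ⟨k, hk⟩ := h
    refine ⟨k, fun l => ⟨fun hkl => OnePoint.coe_injective hkl ▸ hk, fun hl => ?_⟩⟩
    by_contra hkl
    refine isNMeeting_two_iff.1 hK _ hk _ hl (Subtype.ext ?_)
    exact Set.singleton_inter_eq_empty.2 fun h => hkl (congrArg _ h)
  · exact ⟨OnePoint.infty, fun k => iff_of_false (OnePoint.infty_ne_coe k) fun hk => h ⟨k, hk⟩⟩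

theorem isNFree_two : IsNFree.{u, v} 2 (FinCo κ) :=
  ⟨Set.range singleton, isNFreeOver_of_closure_eq_top closure_range_singleton fun _ hK =>
    let ⟨o, ho⟩ := exists_singleton_mem_ult_iff hK
    ⟨ult o, Set.forall_mem_range.2 ho⟩⟩

lemma bijective_ult : Function.Bijective (ult : OnePoint κ → Ult (FinCo κ)) := by
  refine ⟨fun o o' h => ?_, fun p => ?_⟩
  · have hiff (k : κ) : o = k ↔ o' = k := by rw [← singleton_mem_ult, h, singleton_mem_ult]
    induction o with
    | infty =>
      induction o' with
      | infty => rfl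
      | coe k => exact (hiff k).2 rfl
    | coe k => exact ((hiff k).1 rfl).symm
  · obtain ⟨o, ho⟩ := exists_singleton_mem_ult_iff (p.isNMeeting 2)
    exact ⟨o, Ult.eq_of_closure_eq_top closure_range_singleton (Set.forall_mem_range.2 ho)⟩

lemma continuous_ult [TopologicalSpace κ] [DiscreteTopology κ] :
    Continuous (ult : OnePoint κ → Ult (FinCo κ)) := by
  rw [OnePoint.continuous_iff_from_discrete, Ult.nhds_eq]
  simp only [Filter.tendsto_iInf, Filter.tendsto_principal]
  intro s hs
  exact s.2.resolve_left fun hfin => hfin.notMem_hyperfilter hs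

/-- The dual space of the finite-cofinite algebra is the one-point compactification of a discrete
space. -/
noncomputable def onePointHomeomorph [TopologicalSpace κ] [DiscreteTopology κ] :
    OnePoint κ ≃ₜ Ult (FinCo κ) :=
  Continuous.homeoOfEquivCompactToT2 (f := Equiv.ofBijective _ bijective_ult) continuous_ult

end FinCo

end FinCo

section Fr

variable {κ : Type u}

namespace Fr

/-- The free generators of `Fr κ`. -/
def gen (k : κ) : Fr κ := ⟨{f | f k = true}, BooleanSubalgebra.subset_closure ⟨k, rfl⟩⟩

lemma closure_range_gen : BooleanSubalgebra.closure (Set.range (gen : κ → Fr κ)) = ⊤ := by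
  refine eq_top_iff.2 fun ⟨s, hs⟩ _ => ?_
  induction hs using BooleanSubalgebra.closure_bot_sup_induction with
  | mem x hx =>
    obtain ⟨k, rfl⟩ := hx
    exact BooleanSubalgebra.subset_closure ⟨k, rfl⟩
  | bot => exact BooleanSubalgebra.bot_mem
  | sup x hx y hy ihx ihy => exact BooleanSubalgebra.sup_mem (ihx trivial) (ihy trivial)
  | compl x hx ih => exact BooleanSubalgebra.compl_mem (ih trivial)

/-- The ultrafilter of `Fr κ` given by a point of the Cantor cube. -/
def ult (f : κ → Bool) : Ult (Fr κ) := (Ult.ofUltrafilter (pure f)).comap (Fr κ).subtype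

lemma gen_mem_ult {f : κ → Bool} {k : κ} : gen k ∈ ult f ↔ f k = true := Iff.rfl

lemma exists_gen_mem_ult_iff (K : Set (Fr κ)) : ∃ f, ∀ k, gen k ∈ ult f ↔ gen k ∈ K := by
  classical
  exact ⟨fun k => decide (gen k ∈ K), fun k => by rw [gen_mem_ult, decide_eq_true_eq]⟩

theorem isNFree (n : ℕ) : IsNFree.{u, v} n (Fr κ) :=
  ⟨Set.range gen, isNFreeOver_of_closure_eq_top closure_range_gen fun K _ =>
    let ⟨f, hf⟩ := exists_gen_mem_ult_iff K
    ⟨ult f, Set.forall_mem_range.2 hf⟩⟩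

lemma bijective_ult : Function.Bijective (ult : (κ → Bool) → Ult (Fr κ)) := by
  refine ⟨fun f f' h => funext fun k => ?_, fun p => ?_⟩
  · rw [Bool.eq_iff_iff, ← gen_mem_ult, h, gen_mem_ult]
  · obtain ⟨f, hf⟩ := exists_gen_mem_ult_iff (p : Set (Fr κ))
    exact ⟨f, Ult.eq_of_closure_eq_top closure_range_gen (Set.forall_mem_range.2 hf)⟩

lemma isClopen_coe (s : Fr κ) : IsClopen (s : Set (κ → Bool)) := by
  obtain ⟨s, hs⟩ := s
  induction hs using BooleanSubalgebra.closure_bot_sup_induction with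
  | mem x hx =>
    obtain ⟨k, rfl⟩ := hx
    exact (isClopen_discrete {true}).preimage (continuous_apply k)
  | bot => exact isClopen_empty
  | sup x _ y _ hx hy => exact hx.union hy
  | compl x _ hx => exact hx.compl

lemma continuous_ult : Continuous (ult : (κ → Bool) → Ult (Fr κ)) := by
  refine continuous_generateFrom_iff.2 ?_
  rintro _ ⟨s, rfl⟩
  exact (isClopen_coe s).isOpen

/-- The dual space of the free algebra is the Cantor cube. -/
noncomputable def cubeHomeomorph : (κ → Bool) ≃ₜ Ult (Fr κ) :=
  Continuous.homeoOfEquivCompactToT2 (f := Equiv.ofBijective _ bijective_ult) continuous_ult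

end Fr

end Fr

theorem IsNFree.isSupercompact_ult_prod {A B : Type u} [BooleanAlgebra A] [BooleanAlgebra B]
    (hA : IsNFree.{u, v} 2 A) (hB : IsNFree.{u, v} 2 B) : IsSupercompact (Ult (A × B)) :=
  (hA.isGraphSpace.isSupercompact.sum hB.isGraphSpace.isSupercompact).of_homeomorph
    (Ult.sumHomeomorphProd A B)

theorem not_isGraphSpace_ult_finCo_prod_fr (κ : Type u) [Uncountable κ] :
    ¬ IsGraphSpace.{u, v} (Ult (FinCo κ × Fr κ)) := by
  rintro ⟨V, G, ⟨h⟩⟩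
  let _ : TopologicalSpace κ := ⊥
  have : DiscreteTopology κ := ⟨rfl⟩
  let hsum := (FinCo.onePointHomeomorph (κ := κ)).sumCongr (Fr.cubeHomeomorph (κ := κ))
  exact not_isGraphSpace_onePoint_sum_cube.{u, v} (κ := κ)
    ⟨V, G, ⟨(hsum.trans (Ult.sumHomeomorphProd _ _)).trans h⟩⟩

theorem mainTheorem6_general (κ : Type u) [Uncountable κ] :
    IsNFree.{u, v} 2 (FinCo κ) ∧
    IsNFree.{u, v} 2 (Fr κ) ∧
    ¬ IsNFree.{u, v} 2 (FinCo κ × Fr κ) ∧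
    IsSupercompact (Ult (FinCo κ × Fr κ)) ∧
    ¬ IsGraphSpace.{u, v} (Ult (FinCo κ × Fr κ)) :=
  ⟨FinCo.isNFree_two, Fr.isNFree 2,
    fun h => not_isGraphSpace_ult_finCo_prod_fr.{u, u} κ h.isGraphSpace,
    FinCo.isNFree_two.{u, v}.isSupercompact_ult_prod (Fr.isNFree 2),
    not_isGraphSpace_ult_finCo_prod_fr κ⟩

instance : Uncountable (ω₁ : Ordinal.{u}).ToType := by
  rw [← Cardinal.aleph0_lt_mk_iff, Cardinal.mk_toType, Ordinal.card_omega]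
  exact Cardinal.aleph0_lt_aleph_one

theorem mainTheorem6 :
    IsNFree.{u, v} 2 (FinCo (ω₁ : Ordinal.{u}).ToType) ∧
    IsNFree.{u, v} 2 (Fr (ω₁ : Ordinal.{u}).ToType) ∧
    ¬ IsNFree.{u, v} 2 (FinCo (ω₁ : Ordinal.{u}).ToType × Fr (ω₁ : Ordinal.{u}).ToType) ∧
    IsSupercompact (Ult (FinCo (ω₁ : Ordinal.{u}).ToType × Fr (ω₁ : Ordinal.{u}).ToType)) ∧
    ¬ IsGraphSpace.{u, v}
      (Ult (FinCo (ω₁ : Ordinal.{u}).ToType × Fr (ω₁ : Ordinal.{u}).ToType)) :=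
  mainTheorem6_general _
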